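/- **Theorem (144-competitive algorithm for monotone SMSP over laminar matroids).** An instance of the monotone submodular matroid secretary problem (MSMSP) consists of a finite ground set $E$ with $n = |E|$ elements, a matroid $\mathcal M = (E, \mathcal I)$, and a non-negative, monotone, submodular function $f \colon 2^E \to \mathbb R_{\ge 0}$, i.e. $f(S)\le f(T)$ for $S\subseteq T$, and $f(A\cup\{e\})-f(A)\ge f(B\cup\{e\})-f(B)$ for $A\subseteq B\subseteq E$ and $e\in E\setminus B$. The elements of $E$ arrive in uniformly random order. A (randomized) online algorithm knows $n$, must irrevocably accept or reject each element on its arrival, and can obtain information about $f$ and $\mathcal M$ only from a value oracle (returning $f(S)$) and an independence oracle (telling whether $S\in\mathcal I$), both restricted to sets $S$ of elements that have already arrived. The algorithm is $\alpha$-competitive over $\mathcal M$ if for every such $f$ the set $Q$ of accepted elements is always independent and $$\mathbb E[f(Q)] \;\ge\; \frac1\alpha\,\max\{f(T) : T\in\mathcal I\},$$ where the expectation is over the arrival order and the internal randomness of the algorithm. A matroid $\mathcal M=(E,\mathcal I)$ is laminar if there are a family $\mathcal F\subseteq 2^E$, any two members of which are nested or disjoint, and capacities $c(B)\in\mathbb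 Z_{\ge0}$, $B\in\mathcal F$, such that $\mathcal I=\{S\subseteq E : |S\cap B|\le c(B)\ \text{for all } B\in\mathcal F\}$. There exists a single randomized online algorithm for MSMSP that is $144$-competitive over every laminar matroid. -/

import Mathlib

/-- `f` satisfies the diminishing returns property
`f(A + e) - f(A) ≥ f(B + e) - f(B)` for `A ⊆ B` and `e ∉ B`. -/
def IsSubmodular {E : Type*} (f : Finset E → ℝ) : Prop :=
  ∀ (A B : Finset E) (e : E) (heA : e ∉ A) (heB : e ∉ B), A ⊆ B →
    f (B.cons e heB) - f B ≤ f (A.cons e heA) - f A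

/-- The objective functions of the monotone submodular matroid secretary problem:
non-negative, monotone and submodular. -/
structure IsMonotoneSubmodularObjective {E : Type*} (f : Finset E → ℝ) : Prop where
  nonneg : ∀ S, 0 ≤ f S
  monotone : ∀ S T, S ⊆ T → f S ≤ f T
  submodular : IsSubmodular f

/-- A matroid is laminar if its independent sets are the sets `S` with `|S ∩ B| ≤ cap B` for all
members `B` of some laminar family `ℱ` (any two members are nested or disjoint) with
capacities `cap`. -/
def IsLaminarMatroid {E : Type*} (M : Matroid E) : Prop :=
  ∃ (ℱ : Set (Set E)) (cap : Set E → ℕ),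
    (∀ B ∈ ℱ, B ⊆ M.E) ∧
    (∀ B ∈ ℱ, ∀ C ∈ ℱ, B ⊆ C ∨ C ⊆ B ∨ Disjoint B C) ∧
    ∀ S : Set E, S ⊆ M.E → (M.Indep S ↔ ∀ B ∈ ℱ, (S ∩ B).encard ≤ cap B)

/-- A randomized online algorithm for the submodular matroid secretary problem.

The algorithm knows the number `n` of elements and draws its internal randomness `s` from the
distribution `coin n`.  Elements are referred to by their arrival times `0, …, n - 1`.  When the
element number `i` arrives, the algorithm decides irrevocably whether to accept it, using only
`n`, `s`, and the answers of the two oracles on sets `S` of elements that have already arrived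
(that is, `S ⊆ Finset.Iic i`): the value of `S` and the truth of "`S` is independent".
Its own earlier decisions are functions of the same data, so they need not be supplied. -/
structure SecretaryAlgorithm where
  Seed : ℕ → Type
  seedFintype : ∀ n, Fintype (Seed n)
  coin : ∀ n, PMF (Seed n)
  accept : ∀ (n : ℕ) (_s : Seed n) (i : Fin n)
    (_value : ∀ S : Finset (Fin n), S ⊆ Finset.Iic i → ℝ)
    (_indep : ∀ S : Finset (Fin n), S ⊆ Finset.Iic i → Prop), Prop

namespace SecretaryAlgorithm

/-- The set of elements accepted by the algorithm on the instance with objective `f` and matroid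
`M`, when the elements arrive in the order `σ 0, σ 1, …` and the internal randomness is `s`. -/
noncomputable def output (A : SecretaryAlgorithm) {E : Type*} [Fintype E]
    (f : Finset E → ℝ) (M : Matroid E) (σ : Fin (Fintype.card E) ≃ E)
    (s : A.Seed (Fintype.card E)) : Finset E :=
  open Classical in
  Finset.univ.filter fun e =>
    A.accept (Fintype.card E) s (σ.symm e)
      (fun S _ => f (S.map σ.toEmbedding))
      (fun S _ => M.Indep (S.map σ.toEmbedding : Finset E))

/-- The expected value of the output, over a uniformly random arrival order `σ` and independent
internal randomness `s` of the algorithm. -/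
noncomputable def expectedValue (A : SecretaryAlgorithm) {E : Type*} [Fintype E]
    (f : Finset E → ℝ) (M : Matroid E) : ℝ :=
  open Classical in
  letI := A.seedFintype (Fintype.card E)
  (∑ σ : Fin (Fintype.card E) ≃ E, ∑ s : A.Seed (Fintype.card E),
      (A.coin (Fintype.card E) s).toReal * f (A.output f M σ s))
    / (Fintype.card (Fin (Fintype.card E) ≃ E) : ℝ)

end SecretaryAlgorithm

/-- The offline optimum: the largest value of an independent set (a supremum over a finite
non-empty family). -/
noncomputable def offlineOptimum {E : Type*} (f : Finset E → ℝ) (M : Matroid E) : ℝ :=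
  ⨆ T : {T : Finset E // M.Indep (T : Set E)}, f T

/-- `A` is `α`-competitive for the monotone submodular matroid secretary problem over the
matroid `M`: on every instance its output is always independent and its expected value is at
least `1 / α` times the offline optimum. -/
def IsCompetitiveForMSMSP (A : SecretaryAlgorithm) (α : ℝ) {E : Type*} [Fintype E]
    (M : Matroid E) : Prop :=
  ∀ f : Finset E → ℝ, IsMonotoneSubmodularObjective f →
    (∀ (σ : Fin (Fintype.card E) ≃ E) (s : A.Seed (Fintype.card E)),
      M.Indep (A.output f M σ s : Set E)) ∧
    1 / α * offlineOptimum f M ≤ A.expectedValue f M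

/-! The algorithm samples a set `H`, each element independently with probability `p = 35/36`, and
simulates greedy on the ground set: a picked element enters the solution `M` if it lies in `H`, and
is otherwise set aside as a candidate. Setting it aside leaves `M` unchanged, so whether an
unsampled element is a candidate is decided on arrival by the sample and that element alone
(`mem_greedyRun_iff`). For the analysis, membership in `H` is revealed only when an element is
picked (`runExpect_step`), so each pick is a candidate with probability `r = 1/36`, whatever
happened before.

Sampling keeps a fraction `p` of the optimum (`le_subsetExpect_inter`) and greedy halves it at worst
(`value_le_two_mul_chosen`). The candidates gain in expectation at least `r` times the value of the
chosen set (`le_runExpect_gain`), up to `f ∅`.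

Every candidate is accepted unless it lies in a crowded set, one with more candidates than its
capacity. An independent chosen set has at most `cap B` elements in `B`, so crowding needs a large
deviation of the coins, which an exponential martingale controls (`runExpect_potential`,
`runExpect_crowded_le`). After removal of redundant constraints the sets through one element have
distinct capacities (`IsLaminarMatroid.exists_family`), so the losses add up to a convergent series,
below 0.45 of the greedy weight (`sum_crowdingLoss_le`). -/

/-! ### Expectations over a random subset. -/

section Expectation

variable {α : Type*}

/-- The expectation of `F H`, where `H` contains every element of `R` independently with
probability `p` (and `r = 1 - p`). -/
noncomputable def subsetExpect (p r : ℝ) (R : Finset α) (F : Finset α → ℝ) : ℝ :=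
  ∑ H ∈ R.powerset, p ^ H.card * r ^ (R.card - H.card) * F H

theorem subsetExpect_insert [DecidableEq α] (p r : ℝ) {R : Finset α} {e : α}
    (he : e ∉ R) (F : Finset α → ℝ) :
    subsetExpect p r (insert e R) F =
      p * subsetExpect p r R (fun H => F (insert e H)) + r * subsetExpect p r R F := by
  unfold subsetExpect
  rw [Finset.sum_powerset_insert he, add_comm, Finset.mul_sum, Finset.mul_sum]
  congr 1
  · refine Finset.sum_congr rfl fun H hH => ?_
    rw [Finset.mem_powerset] at hH
    rw [Finset.card_insert_of_notMem he, Finset.card_insert_of_notMem fun h => he (hH h),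
      Nat.add_sub_add_right, pow_succ]
    ring
  · refine Finset.sum_congr rfl fun H hH => ?_
    rw [Finset.mem_powerset] at hH
    rw [Finset.card_insert_of_notMem he, Nat.succ_sub (Finset.card_le_card hH), pow_succ]
    ring

theorem subsetExpect_const {p r : ℝ} (hpr : p + r = 1) (R : Finset α) (a : ℝ) :
    subsetExpect p r R (fun _ => a) = a := by
  unfold subsetExpect
  rw [← Finset.sum_mul, Finset.sum_pow_mul_eq_add_pow, hpr, one_pow, one_mul]

theorem subsetExpect_mono {p r : ℝ} (hp : 0 ≤ p) (hr : 0 ≤ r) {R : Finset α}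
    {F G : Finset α → ℝ} (h : ∀ H ⊆ R, F H ≤ G H) :
    subsetExpect p r R F ≤ subsetExpect p r R G :=
  Finset.sum_le_sum fun H hH =>
    mul_le_mul_of_nonneg_left (h H (Finset.mem_powerset.1 hH)) (by positivity)

theorem subsetExpect_congr {p r : ℝ} {R : Finset α} {F G : Finset α → ℝ}
    (h : ∀ H ⊆ R, F H = G H) : subsetExpect p r R F = subsetExpect p r R G :=
  Finset.sum_congr rfl fun H hH => by rw [h H (Finset.mem_powerset.1 hH)]

theorem subsetExpect_add (p r : ℝ) (R : Finset α) (F G : Finset α → ℝ) :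
    subsetExpect p r R (fun H => F H + G H) = subsetExpect p r R F + subsetExpect p r R G := by
  simp only [subsetExpect, mul_add, Finset.sum_add_distrib]

theorem subsetExpect_mul (p r a : ℝ) (R : Finset α) (F : Finset α → ℝ) :
    subsetExpect p r R (fun H => a * F H) = a * subsetExpect p r R F := by
  simp only [subsetExpect, Finset.mul_sum]
  exact Finset.sum_congr rfl fun H _ => by ring

theorem subsetExpect_sum {ι : Type*} (p r : ℝ) (R : Finset α) (s : Finset ι)
    (F : ι → Finset α → ℝ) :
    subsetExpect p r R (fun H => ∑ i ∈ s, F i H) = ∑ i ∈ s, subsetExpect p r R (F i) := by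
  simp only [subsetExpect, Finset.mul_sum]
  exact Finset.sum_comm

end Expectation

/-! ### The simulated greedy algorithm and its decision tree. -/

section Greedy

variable {α : Type*} [LinearOrder α]

open Classical in
/-- The elements of `R` that can be added to `M`. -/
noncomputable def feasible (I : Finset α → Prop) (M R : Finset α) : Finset α :=
  R.filter fun e => e ∉ M ∧ I (insert e M)

theorem mem_feasible {I : Finset α → Prop} {M R : Finset α} {e : α} :
    e ∈ feasible I M R ↔ e ∈ R ∧ e ∉ M ∧ I (insert e M) := by
  classical
  simp [feasible]

/-- `e` is the element that the greedy algorithm adds to `M`: it maximizes the value, and ties are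
broken by the order of the ground set. -/
def IsBest (f : Finset α → ℝ) (I : Finset α → Prop) (M R : Finset α) (e : α) : Prop :=
  e ∈ feasible I M R ∧ ∀ x ∈ feasible I M R,
    toLex (f (insert x M), x) ≤ toLex (f (insert e M), e)

theorem exists_isBest (f : Finset α → ℝ) {I : Finset α → Prop} {M R : Finset α}
    (h : (feasible I M R).Nonempty) : ∃ e, IsBest f I M R e :=
  (feasible I M R).exists_max_image (fun x => toLex (f (insert x M), x)) h

namespace IsBest

variable {f : Finset α → ℝ} {I : Finset α → Prop} {M R : Finset α} {e : α}

theorem mem (h : IsBest f I M R e) : e ∈ R := (mem_feasible.1 h.1).1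

theorem notMem (h : IsBest f I M R e) : e ∉ M := (mem_feasible.1 h.1).2.1

theorem indep (h : IsBest f I M R e) : I (insert e M) := (mem_feasible.1 h.1).2.2

theorem le (h : IsBest f I M R e) {x : α} (hx : x ∈ feasible I M R) :
    f (insert x M) ≤ f (insert e M) := by
  rcases Prod.Lex.toLex_le_toLex.1 (h.2 x hx) with h | h
  · exact h.le
  · exact h.1.le

theorem unique (h : IsBest f I M R e) {e' : α} (h' : IsBest f I M R e') : e = e' := by
  have := le_antisymm (h.2 e' h'.1) (h'.2 e h.1)
  simpa using (congrArg (fun q => (ofLex q).2) this).symm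

theorem of_subset (h : IsBest f I M R e) {R' : Finset α} (hR : R' ⊆ R) (he : e ∈ R') :
    IsBest f I M R' e :=
  ⟨mem_feasible.2 ⟨he, h.notMem, h.indep⟩, fun x hx => h.2 x <| by
    rw [mem_feasible] at hx ⊢
    exact ⟨hR hx.1, hx.2⟩⟩

end IsBest

/-- The run of the greedy algorithm that has already chosen `M` and may still look at the
elements of `R`.  A picked element is chosen only if it belongs to `H`.  The result lists the
picked elements, each with the information whether it was chosen. -/
noncomputable def greedyRun (f : Finset α → ℝ) (I : Finset α → Prop) (H M R : Finset α) :
    List (α × Bool) :=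
  open Classical in
  if h : (feasible I M R).Nonempty then
    if (exists_isBest f h).choose ∈ H then
      ((exists_isBest f h).choose, true) ::
        greedyRun f I H (insert (exists_isBest f h).choose M) (R.erase (exists_isBest f h).choose)
    else
      ((exists_isBest f h).choose, false) ::
        greedyRun f I H M (R.erase (exists_isBest f h).choose)
  else []
termination_by R.card
decreasing_by
  all_goals exact Finset.card_erase_lt_of_mem (exists_isBest f h).choose_spec.mem

variable {f : Finset α → ℝ} {I : Finset α → Prop} {H M R : Finset α} {e : α}

theorem greedyRun_stop (f : Finset α → ℝ) (H : Finset α) (h : ¬ (feasible I M R).Nonempty) :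
    greedyRun f I H M R = [] := by
  rw [greedyRun, dif_neg h]

theorem greedyRun_mem (h : IsBest f I M R e) (he : e ∈ H) :
    greedyRun f I H M R = (e, true) :: greedyRun f I H (insert e M) (R.erase e) := by
  have hne : (feasible I M R).Nonempty := ⟨e, h.1⟩
  have := (exists_isBest f hne).choose_spec.unique h
  rw [greedyRun, dif_pos hne, this, if_pos he]

theorem greedyRun_notMem (h : IsBest f I M R e) (he : e ∉ H) :
    greedyRun f I H M R = (e, false) :: greedyRun f I H M (R.erase e) := by
  have hne : (feasible I M R).Nonempty := ⟨e, h.1⟩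
  have := (exists_isBest f hne).choose_spec.unique h
  rw [greedyRun, dif_pos hne, this, if_neg he]

/-- Induction along the decision tree of the greedy algorithm. -/
theorem greedy_induction (f : Finset α → ℝ) (I : Finset α → Prop)
    {P : Finset α → Finset α → Prop}
    (base : ∀ M R, ¬ (feasible I M R).Nonempty → P M R)
    (step : ∀ M R e, IsBest f I M R e → P (insert e M) (R.erase e) → P M (R.erase e) → P M R) :
    ∀ M R, P M R := by
  intro M R
  induction hn : R.card using Nat.strong_induction_on generalizing M R with
  | _ n ih =>
    by_cases h : (feasible I M R).Nonempty
    · obtain ⟨e, he⟩ := exists_isBest f h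
      have hlt : (R.erase e).card < n := hn ▸ Finset.card_erase_lt_of_mem he.mem
      exact step M R e he (ih _ hlt _ _ rfl) (ih _ hlt _ _ rfl)
    · exact base M R h

theorem greedyRun_congr_sample {H' : Finset α} (M R : Finset α) :
    (∀ x ∈ R, x ∈ H ↔ x ∈ H') → greedyRun f I H M R = greedyRun f I H' M R := by
  refine greedy_induction f I (P := fun M R => (∀ x ∈ R, x ∈ H ↔ x ∈ H') →
    greedyRun f I H M R = greedyRun f I H' M R) ?_ ?_ M R
  · intro M R h _
    rw [greedyRun_stop f H h, greedyRun_stop f H' h]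
  · intro M R e he ih₁ ih₂ hH
    have hR : ∀ x ∈ R.erase e, x ∈ H ↔ x ∈ H' := fun x hx => hH x (Finset.mem_of_mem_erase hx)
    by_cases h : e ∈ H
    · rw [greedyRun_mem he h, greedyRun_mem he ((hH e he.mem).1 h), ih₁ hR]
    · rw [greedyRun_notMem he h, greedyRun_notMem he (mt (hH e he.mem).2 h), ih₂ hR]

/-- The run uses only the values and the independence of sets of available elements. -/
theorem greedyRun_congr_oracle {f' : Finset α → ℝ} {I' : Finset α → Prop} {A : Finset α}
    (hf : ∀ S ⊆ A, f S = f' S) (hI : ∀ S ⊆ A, I S ↔ I' S) (M R : Finset α) :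
    M ⊆ A → R ⊆ A → greedyRun f I H M R = greedyRun f' I' H M R := by
  have hfeas : ∀ M R, M ⊆ A → R ⊆ A → feasible I M R = feasible I' M R := by
    intro M R hM hR
    ext x
    rw [mem_feasible, mem_feasible]
    refine and_congr_right fun hx => and_congr_right fun _ => hI _ ?_
    exact Finset.insert_subset (hR hx) hM
  refine greedy_induction f I (P := fun M R => M ⊆ A → R ⊆ A →
    greedyRun f I H M R = greedyRun f' I' H M R) ?_ ?_ M R
  · intro M R h hM hR
    rw [greedyRun_stop f H h, greedyRun_stop f' H (hfeas M R hM hR ▸ h)]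
  · intro M R e he ih₁ ih₂ hM hR
    have he' : IsBest f' I' M R e := by
      refine ⟨hfeas M R hM hR ▸ he.1, fun x hx => ?_⟩
      rw [← hfeas M R hM hR] at hx
      rw [← hf _ (Finset.insert_subset (hR (mem_feasible.1 hx).1) hM),
        ← hf _ (Finset.insert_subset (hR he.mem) hM)]
      exact he.2 x hx
    have hR' : R.erase e ⊆ A := (Finset.erase_subset _ _).trans hR
    by_cases h : e ∈ H
    · rw [greedyRun_mem he h, greedyRun_mem he' h,
        ih₁ (Finset.insert_subset (hR he.mem) hM) hR']
    · rw [greedyRun_notMem he h, greedyRun_notMem he' h, ih₂ hM hR']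

/-- Whether `e ∉ H` is picked does not depend on the other elements outside `H`. -/
theorem mem_greedyRun_iff (f : Finset α → ℝ) (I : Finset α → Prop) (H : Finset α) (e : α)
    (M R : Finset α) : ∀ R' ⊆ R, R ∩ insert e H ⊆ R' →
      ((e, false) ∈ greedyRun f I H M R ↔ (e, false) ∈ greedyRun f I H M R') := by
  refine greedy_induction f I (P := fun M R => ∀ R' ⊆ R, R ∩ insert e H ⊆ R' →
      ((e, false) ∈ greedyRun f I H M R ↔ (e, false) ∈ greedyRun f I H M R')) ?_ ?_ M R
  · intro M R h R' hR' _
    have h' : ¬ (feasible I M R').Nonempty := by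
      rintro ⟨x, hx⟩
      rw [mem_feasible] at hx
      exact h ⟨x, mem_feasible.2 ⟨hR' hx.1, hx.2⟩⟩
    rw [greedyRun_stop f H h, greedyRun_stop f H h']
  · intro M R x hx ih₁ ih₂ R' hR' hi
    have hsub : R'.erase x ⊆ R.erase x := Finset.erase_subset_erase _ hR'
    have hsup : R.erase x ∩ insert e H ⊆ R'.erase x := by
      intro a ha
      rw [Finset.mem_inter, Finset.mem_erase] at ha
      exact Finset.mem_erase.2 ⟨ha.1.1, hi (Finset.mem_inter.2 ⟨ha.1.2, ha.2⟩)⟩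
    by_cases hxR : x ∈ R'
    · have hx' := hx.of_subset hR' hxR
      by_cases hH : x ∈ H
      · rw [greedyRun_mem hx hH, greedyRun_mem hx' hH, List.mem_cons, List.mem_cons,
          ih₁ _ hsub hsup]
      · rw [greedyRun_notMem hx hH, greedyRun_notMem hx' hH, List.mem_cons, List.mem_cons,
          ih₂ _ hsub hsup]
    -- The larger set picks an unsampled `x` missing from `R'`; this leaves `M` unchanged, so the
    -- two runs stay in step.
    · have hxn : x ∉ insert e H := fun h => hxR (hi (Finset.mem_inter.2 ⟨hx.mem, h⟩))
      rw [Finset.mem_insert, not_or] at hxn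
      rw [greedyRun_notMem hx hxn.2, List.mem_cons]
      rw [Finset.erase_eq_of_notMem hxR] at hsub hsup
      rw [ih₂ _ hsub hsup]
      simp [Ne.symm hxn.1]

/-- The expectation of a function of the run, for a random `H`. -/
noncomputable def runExpect (p r : ℝ) (f : Finset α → ℝ) (I : Finset α → Prop) (M R : Finset α)
    (Φ : List (α × Bool) → ℝ) : ℝ :=
  subsetExpect p r R fun H => Φ (greedyRun f I H M R)

theorem runExpect_stop {p r : ℝ} (hpr : p + r = 1) (h : ¬ (feasible I M R).Nonempty)
    (Φ : List (α × Bool) → ℝ) : runExpect p r f I M R Φ = Φ [] := by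
  unfold runExpect
  simp only [greedyRun_stop f _ h]
  exact subsetExpect_const hpr _ _

/-- Deferred decision: `e` is erased once picked, so the rest of the run is independent of whether
`e ∈ H`. -/
theorem runExpect_step (p r : ℝ) (he : IsBest f I M R e) (Φ : List (α × Bool) → ℝ) :
    runExpect p r f I M R Φ =
      p * runExpect p r f I (insert e M) (R.erase e) (fun L => Φ ((e, true) :: L)) +
      r * runExpect p r f I M (R.erase e) (fun L => Φ ((e, false) :: L)) := by
  have hR := Finset.insert_erase he.mem
  have : runExpect p r f I M R Φ =
      subsetExpect p r (insert e (R.erase e)) fun H => Φ (greedyRun f I H M R) := by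
    rw [hR, runExpect]
  rw [this, subsetExpect_insert p r (Finset.notMem_erase e R)]
  unfold runExpect
  congr 2
  · refine subsetExpect_congr fun H hH => ?_
    rw [greedyRun_mem he (Finset.mem_insert_self e H)]
    congr 2
    refine greedyRun_congr_sample _ _ fun x hx => ?_
    simp [Finset.ne_of_mem_erase hx]
  · refine subsetExpect_congr fun H hH => ?_
    rw [greedyRun_notMem he fun h => Finset.notMem_erase e R (hH h)]

end Greedy

/-! ### Marginal values and random sampling of a submodular function. -/

section Objective

variable {α : Type*} [DecidableEq α] {f : Finset α → ℝ}

theorem IsMonotoneSubmodularObjective.marginal_le (hf : IsMonotoneSubmodularObjective f)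
    {A B : Finset α} (h : A ⊆ B) (e : α) : f (insert e B) - f B ≤ f (insert e A) - f A := by
  by_cases heB : e ∈ B
  · rw [Finset.insert_eq_of_mem heB, sub_self]
    exact sub_nonneg.2 (hf.monotone _ _ (Finset.subset_insert e A))
  · have := hf.submodular A B e (fun h' => heB (h h')) heB h
    rwa [Finset.cons_eq_insert, Finset.cons_eq_insert] at this

/-- Sampling from `T` yields in expectation at least a `p` fraction of its value. -/
theorem IsMonotoneSubmodularObjective.le_subsetExpect_inter
    (hf : IsMonotoneSubmodularObjective f) {p r : ℝ} (hp : 0 ≤ p) (hr : 0 ≤ r) (hpr : p + r = 1)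
    (T R : Finset α) : ∀ A : Finset α,
      r * f A + p * f (A ∪ T ∩ R) ≤ subsetExpect p r R fun H => f (A ∪ T ∩ H) := by
  induction R using Finset.induction_on with
  | empty =>
    intro A
    simp only [Finset.inter_empty, Finset.union_empty, subsetExpect, Finset.powerset_empty,
      Finset.sum_singleton, Finset.card_empty, pow_zero, one_mul]
    rw [← add_mul, add_comm r, hpr, one_mul]
    simp
  | insert e R he ih =>
    intro A
    rw [subsetExpect_insert p r he]
    by_cases heT : e ∈ T
    · simp only [Finset.inter_insert_of_mem heT, Finset.union_insert, ← Finset.insert_union]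
      have h₁ := mul_le_mul_of_nonneg_left (ih (insert e A)) hp
      have h₂ := mul_le_mul_of_nonneg_left (ih A) hr
      have h₃ := mul_le_mul_of_nonneg_left
        (hf.marginal_le (Finset.subset_union_left : A ⊆ A ∪ T ∩ R) e) (mul_nonneg hp hr)
      rw [← Finset.insert_union] at h₃
      have hp' : p = 1 - r := by linarith
      subst hp'
      linarith
    · simp only [Finset.inter_insert_of_notMem heT]
      rw [← add_mul, hpr, one_mul]
      exact ih A

end Objective

/-! ### Statistics of a single run. -/

section Outcome

variable {α : Type*} [LinearOrder α]

/-- The elements chosen at the end of a run that starts with `M`. -/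
def chosen (M : Finset α) : List (α × Bool) → Finset α
  | [] => M
  | (e, true) :: L => chosen (insert e M) L
  | (_, false) :: L => chosen M L

/-- The elements that were picked but not chosen. -/
def candidates : List (α × Bool) → Finset α
  | [] => ∅
  | (_, true) :: L => candidates L
  | (e, false) :: L => insert e (candidates L)

/-- The number of candidates in `B`. -/
def candidateCount (B : Finset α) : List (α × Bool) → ℕ
  | [] => 0
  | (_, true) :: L => candidateCount B L
  | (e, false) :: L => candidateCount B L + if e ∈ B then 1 else 0

/-- The sum of the greedy marginal values of the candidates, weighted by `φ`. -/
def candidateWeight (f : Finset α → ℝ) (φ : α → ℝ) (M : Finset α) : List (α × Bool) → ℝ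
  | [] => 0
  | (e, true) :: L => candidateWeight f φ (insert e M) L
  | (e, false) :: L => φ e * (f (insert e M) - f M) + candidateWeight f φ M L

/-- The sum of the marginal values of the candidates with respect to all elements picked before
them, and `A`. -/
def candidateGain (f : Finset α → ℝ) (M A : Finset α) : List (α × Bool) → ℝ
  | [] => 0
  | (e, true) :: L => candidateGain f (insert e M) A L
  | (e, false) :: L =>
      (f (insert e (M ∪ A)) - f (M ∪ A)) + candidateGain f M (insert e A) L

theorem mem_candidates {L : List (α × Bool)} {e : α} : e ∈ candidates L ↔ (e, false) ∈ L := by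
  induction L with
  | nil => simp [candidates]
  | cons x L ih =>
    obtain ⟨a, b⟩ := x
    cases b <;> simp [candidates, ih]

/-- Equality would need that no element is picked twice; this direction suffices to turn a bound on
the count into one on the set. -/
theorem card_candidates_inter_le (B : Finset α) (L : List (α × Bool)) :
    (candidates L ∩ B).card ≤ candidateCount B L := by
  induction L with
  | nil => simp [candidates, candidateCount]
  | cons x L ih =>
    obtain ⟨a, b⟩ := x
    cases b
    · simp only [candidates, candidateCount]
      split_ifs with h
      · rw [Finset.insert_inter_of_mem h]
        exact (Finset.card_insert_le _ _).trans (by omega)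
      · rwa [Finset.insert_inter_of_notMem h, add_zero]
    · simpa only [candidates, candidateCount] using ih

theorem subset_chosen (M : Finset α) (L : List (α × Bool)) : M ⊆ chosen M L := by
  induction L generalizing M with
  | nil => exact subset_rfl
  | cons x L ih =>
    obtain ⟨a, b⟩ := x
    cases b
    · exact ih M
    · exact (Finset.subset_insert a M).trans (ih _)

variable {f : Finset α → ℝ} {I : Finset α → Prop}

theorem candidateWeight_mono (hf : IsMonotoneSubmodularObjective f) {φ ψ : α → ℝ}
    (h : ∀ e, φ e ≤ ψ e) (M : Finset α) (L : List (α × Bool)) :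
    candidateWeight f φ M L ≤ candidateWeight f ψ M L := by
  induction L generalizing M with
  | nil => exact le_rfl
  | cons x L ih =>
    obtain ⟨a, b⟩ := x
    cases b
    · exact add_le_add (mul_le_mul_of_nonneg_right (h a)
        (sub_nonneg.2 (hf.monotone _ _ (Finset.subset_insert a M)))) (ih M)
    · exact ih _

theorem candidateWeight_sum {ι : Type*} (f : Finset α → ℝ) (s : Finset ι) (a : ι → ℝ)
    (φ : ι → α → ℝ) (M : Finset α) (L : List (α × Bool)) :
    candidateWeight f (fun e => ∑ i ∈ s, a i * φ i e) M L =
      ∑ i ∈ s, a i * candidateWeight f (φ i) M L := by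
  induction L generalizing M with
  | nil => simp [candidateWeight]
  | cons x L ih =>
    obtain ⟨e, b⟩ := x
    cases b
    · simp only [candidateWeight, ih, mul_add, Finset.sum_add_distrib, Finset.sum_mul, mul_assoc]
    · exact ih _

theorem candidateWeight_const (f : Finset α → ℝ) (a : ℝ) (M : Finset α) (L : List (α × Bool)) :
    candidateWeight f (fun _ => a) M L = a * candidateWeight f (fun _ => 1) M L := by
  simpa using candidateWeight_sum f {()} (fun _ => a) (fun _ _ => 1) M L

theorem candidateWeight_nonneg (hf : IsMonotoneSubmodularObjective f) {φ : α → ℝ}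
    (h : ∀ e, 0 ≤ φ e) (M : Finset α) (L : List (α × Bool)) : 0 ≤ candidateWeight f φ M L := by
  have := candidateWeight_mono hf h M L
  rwa [candidateWeight_const, zero_mul] at this

/-- The value of a set of candidates is at least the total gain minus the greedy weight of the
omitted candidates. -/
theorem gain_le_value (hf : IsMonotoneSubmodularObjective f) (Q : Finset α) (M A A' : Finset α)
    (hA : A' ⊆ A) (L : List (α × Bool)) :
    f A' + candidateGain f M A L - candidateWeight f (fun e => if e ∈ Q then 0 else 1) M L ≤
      f (A' ∪ candidates L ∩ Q) := by
  induction L generalizing M A A' with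
  | nil => simp [candidateGain, candidateWeight, candidates]
  | cons x L ih =>
    obtain ⟨e, b⟩ := x
    cases b
    · simp only [candidateGain, candidateWeight, candidates]
      split_ifs with h
      · rw [Finset.insert_inter_of_mem h, Finset.union_insert, ← Finset.insert_union e A']
        -- A kept candidate adds at least its gain, since `A' ⊆ M ∪ A`.
        have h₁ := ih M (insert e A) (insert e A') (Finset.insert_subset_insert e hA)
        have h₂ := hf.marginal_le (hA.trans Finset.subset_union_right : A' ⊆ M ∪ A) e
        linarith
      · rw [Finset.insert_inter_of_notMem h]
        -- An omitted candidate has gain at most its greedy weight, since `M ⊆ M ∪ A`.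
        have h₁ := ih M (insert e A) A' (hA.trans (Finset.subset_insert e A))
        have h₂ := hf.marginal_le (Finset.subset_union_left : M ⊆ M ∪ A) e
        linarith
    · exact ih (insert e M) A A' hA

theorem indep_chosen (H M R : Finset α) : I M → I (chosen M (greedyRun f I H M R)) := by
  refine greedy_induction f I
    (P := fun M R => I M → I (chosen M (greedyRun f I H M R))) ?_ ?_ M R
  · intro M R h hM
    rwa [greedyRun_stop f H h]
  · intro M R e he ih₁ ih₂ hM
    by_cases h : e ∈ H
    · rw [greedyRun_mem he h]
      exact ih₁ he.indep
    · rw [greedyRun_notMem he h]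
      exact ih₂ hM

/-- The greedy weights never exceed the first one. -/
theorem candidateWeight_le (hf : IsMonotoneSubmodularObjective f)
    (hI : ∀ S T : Finset α, S ⊆ T → I T → I S) (H B : Finset α) {w : ℝ}
    (M R : Finset α) : (∀ x ∈ feasible I M R, f (insert x M) - f M ≤ w) →
      candidateWeight f (fun e => if e ∈ B then 1 else 0) M (greedyRun f I H M R) ≤
        w * candidateCount B (greedyRun f I H M R) := by
  refine greedy_induction f I (P := fun M R => (∀ x ∈ feasible I M R, f (insert x M) - f M ≤ w) →
      candidateWeight f (fun e => if e ∈ B then 1 else 0) M (greedyRun f I H M R) ≤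
        w * candidateCount B (greedyRun f I H M R)) ?_ ?_ M R
  · intro M R h _
    simp [greedyRun_stop f H h, candidateWeight, candidateCount]
  · intro M R e he ih₁ ih₂ hM
    by_cases h : e ∈ H
    · rw [greedyRun_mem he h]
      -- Enlarging `M` only shrinks the feasible set and the marginal values, so `w` remains a
      -- bound.
      refine ih₁ fun x hx => ?_
      rw [mem_feasible] at hx
      have hsub : insert x M ⊆ insert x (insert e M) :=
        Finset.insert_subset_insert x (Finset.subset_insert e M)
      exact (hf.marginal_le (Finset.subset_insert e M) x).trans <| hM x <| mem_feasible.2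
        ⟨Finset.mem_of_mem_erase hx.1, fun hxM => hx.2.1 (Finset.mem_insert_of_mem hxM),
          hI _ _ hsub hx.2.2⟩
    · rw [greedyRun_notMem he h]
      have ih := ih₂ fun x hx => hM x <| by
        rw [mem_feasible] at hx ⊢
        exact ⟨Finset.mem_of_mem_erase hx.1, hx.2⟩
      simp only [candidateWeight, candidateCount]
      have h₁ := hM e he.1
      split_ifs with hB
      · push_cast
        linarith
      · simpa using ih

/-- Greedy is a `1/2`-approximation on the sample. -/
theorem value_le_two_mul_chosen (hf : IsMonotoneSubmodularObjective f)
    (hI : ∀ S T : Finset α, S ⊆ T → I T → I S)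
    (hX : ∀ (A T : Finset α) (e : α), I (insert e A) → I (A ∪ T) → ∃ t ∈ insert e T,
      ∃ T' ⊆ T.erase e, I (insert e A ∪ T') ∧ T ⊆ insert e (insert t T'))
    (H M R : Finset α) : ∀ T ⊆ R, T ⊆ H → I (M ∪ T) →
      f (chosen M (greedyRun f I H M R) ∪ T) + f M ≤
        2 * f (chosen M (greedyRun f I H M R)) := by
  refine greedy_induction f I (P := fun M R => ∀ T ⊆ R, T ⊆ H → I (M ∪ T) →
      f (chosen M (greedyRun f I H M R) ∪ T) + f M ≤
        2 * f (chosen M (greedyRun f I H M R))) ?_ ?_ M R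
  · intro M R h T hTR _ hMT
    rw [greedyRun_stop f H h]
    have hTM : T ⊆ M := by
      intro t ht
      by_contra htM
      refine h ⟨t, mem_feasible.2 ⟨hTR ht, htM, hI _ _ ?_ hMT⟩⟩
      exact Finset.insert_subset (Finset.mem_union_right _ ht) Finset.subset_union_left
    rw [chosen, Finset.union_eq_left.2 hTM]
    linarith
  · intro M R e he ih₁ ih₂ T hTR hTH hMT
    by_cases h : e ∈ H
    · rw [greedyRun_mem he h]
      -- Choosing `e` costs `T` at most one further element `t`, whose marginal value over `M` is at
      -- most that of `e`.
      obtain ⟨t, ht, T', hT', hind, hcov⟩ := hX M T e he.indep hMT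
      have ih := ih₁ T' (hT'.trans (Finset.erase_subset_erase e hTR))
        (hT'.trans ((Finset.erase_subset e T).trans hTH)) hind
      simp only [chosen]
      set C := chosen (insert e M) (greedyRun f I H (insert e M) (R.erase e))
      have hC : insert e M ⊆ C := subset_chosen _ _
      have h₁ : f (C ∪ T) ≤ f (insert t (C ∪ T')) := by
        refine hf.monotone _ _ (Finset.union_subset ?_ ?_)
        · exact Finset.subset_union_left.trans (Finset.subset_insert _ _)
        · refine hcov.trans (Finset.insert_subset ?_ ?_)
          · exact Finset.mem_insert_of_mem
              (Finset.mem_union_left _ (hC (Finset.mem_insert_self e M)))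
          · exact Finset.insert_subset_insert t Finset.subset_union_right
      have h₂ := hf.marginal_le
        (((Finset.subset_insert e M).trans hC).trans
          Finset.subset_union_left : M ⊆ C ∪ T') t
      have h₃ : f (insert t M) ≤ f (insert e M) := by
        rcases Finset.mem_insert.1 ht with rfl | ht
        · exact le_rfl
        · by_cases htM : t ∈ M
          · rw [Finset.insert_eq_of_mem htM]
            exact hf.monotone _ _ (Finset.subset_insert e M)
          · refine he.le (mem_feasible.2 ⟨hTR ht, htM, hI _ _ ?_ hMT⟩)
            exact Finset.insert_subset (Finset.mem_union_right _ ht) Finset.subset_union_left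
      linarith
    · rw [greedyRun_notMem he h]
      refine ih₂ T (fun x hx => Finset.mem_erase.2 ⟨?_, hTR hx⟩) hTH hMT
      rintro rfl
      exact h (hTH hx)

end Outcome

/-! ### Expected gain, weight and potential of a run. -/

section RunExpectation

variable {α : Type*} [LinearOrder α] {f : Finset α → ℝ} {I : Finset α → Prop} {p r : ℝ}

theorem runExpect_mono (hp : 0 ≤ p) (hr : 0 ≤ r) {M R : Finset α} {Φ Ψ : List (α × Bool) → ℝ}
    (h : ∀ H ⊆ R, Φ (greedyRun f I H M R) ≤ Ψ (greedyRun f I H M R)) :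
    runExpect p r f I M R Φ ≤ runExpect p r f I M R Ψ :=
  subsetExpect_mono hp hr h

theorem runExpect_add (p r : ℝ) (M R : Finset α) (Φ Ψ : List (α × Bool) → ℝ) :
    runExpect p r f I M R (fun L => Φ L + Ψ L) =
      runExpect p r f I M R Φ + runExpect p r f I M R Ψ :=
  subsetExpect_add p r R _ _

theorem runExpect_mul (p r a : ℝ) (M R : Finset α) (Φ : List (α × Bool) → ℝ) :
    runExpect p r f I M R (fun L => a * Φ L) = a * runExpect p r f I M R Φ :=
  subsetExpect_mul p r a R _

theorem runExpect_const (hpr : p + r = 1) (M R : Finset α) (a : ℝ) :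
    runExpect p r f I M R (fun _ => a) = a :=
  subsetExpect_const hpr R a

theorem runExpect_nonneg (hp : 0 ≤ p) (hr : 0 ≤ r) (hpr : p + r = 1) {M R : Finset α}
    {Φ : List (α × Bool) → ℝ} (h : ∀ L, 0 ≤ Φ L) : 0 ≤ runExpect p r f I M R Φ := by
  rw [← runExpect_const (f := f) (I := I) hpr M R 0]
  exact runExpect_mono hp hr fun _ _ => h _

/-- Candidates contribute a fraction of at least `r` of the expected gain. -/
theorem le_runExpect_gain (hf : IsMonotoneSubmodularObjective f) (hr : 0 ≤ r)
    (hpr : p + r = 1) (hp : 0 ≤ p) (M R : Finset α) : ∀ A : Finset α,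
      r * (runExpect p r f I M R (fun L => f (chosen M L)) - f (M ∪ A)) ≤
        runExpect p r f I M R (candidateGain f M A) := by
  refine greedy_induction f I (P := fun M R => ∀ A : Finset α,
      r * (runExpect p r f I M R (fun L => f (chosen M L)) - f (M ∪ A)) ≤
        runExpect p r f I M R (candidateGain f M A)) ?_ ?_ M R
  · intro M R h A
    rw [runExpect_stop hpr h, runExpect_stop hpr h, chosen, candidateGain]
    exact mul_nonpos_of_nonneg_of_nonpos hr
      (sub_nonpos.2 (hf.monotone _ _ Finset.subset_union_left))
  · intro M R e he ih₁ ih₂ A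
    rw [runExpect_step p r he, runExpect_step p r he]
    simp only [chosen, candidateGain, runExpect_add, runExpect_const hpr]
    -- Both branches enlarge `M ∪ A` by the same `e`; its marginal value is credited to the
    -- candidates only in the branch of probability `r`.
    have h₁ := mul_le_mul_of_nonneg_left (ih₁ A) hp
    have h₂ := mul_le_mul_of_nonneg_left (ih₂ (insert e A)) hr
    rw [Finset.insert_union] at h₁
    rw [Finset.union_insert] at h₂
    have hp' : p = 1 - r := by linarith
    subst hp'
    linarith

/-- Each pick adds the same marginal value over `M` to the chosen set with probability `p` and to
the candidate weight with probability `r`. -/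
theorem mul_runExpect_weight (hpr : p + r = 1) (M R : Finset α) :
    p * runExpect p r f I M R (candidateWeight f (fun _ => 1) M) =
      r * (runExpect p r f I M R (fun L => f (chosen M L)) - f M) := by
  refine greedy_induction f I (P := fun M R =>
    p * runExpect p r f I M R (candidateWeight f (fun _ => 1) M) =
      r * (runExpect p r f I M R (fun L => f (chosen M L)) - f M)) ?_ ?_ M R
  · intro M R h
    rw [runExpect_stop hpr h, runExpect_stop hpr h, chosen, candidateWeight]
    ring
  · intro M R e he ih₁ ih₂
    rw [runExpect_step p r he, runExpect_step p r he]
    simp only [chosen, candidateWeight, runExpect_add, runExpect_const hpr]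
    have hp' : p = 1 - r := by linarith
    subst hp'
    linear_combination (1 - r) * ih₁ + r * ih₂

/-- The exponential potential of the candidates and the chosen elements in `B` is a martingale. -/
theorem runExpect_potential (hpr : p + r = 1) {y z : ℝ} (hyz : p * y + r * z = 1)
    (B M R : Finset α) :
    runExpect p r f I M R (fun L => z ^ candidateCount B L * y ^ (chosen M L ∩ B).card) =
      y ^ (M ∩ B).card := by
  refine greedy_induction f I (P := fun M R =>
    runExpect p r f I M R (fun L => z ^ candidateCount B L * y ^ (chosen M L ∩ B).card) =
      y ^ (M ∩ B).card) ?_ ?_ M R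
  · intro M R h
    rw [runExpect_stop hpr h, chosen, candidateCount, pow_zero, one_mul]
  · intro M R e he ih₁ ih₂
    rw [runExpect_step p r he]
    simp only [chosen, candidateCount]
    rw [ih₁]
    by_cases hB : e ∈ B
    · simp only [if_pos hB, pow_succ, mul_comm _ z, mul_assoc, runExpect_mul, ih₂]
      rw [Finset.insert_inter_of_mem hB, Finset.card_insert_of_notMem
        fun h => he.notMem (Finset.mem_inter.1 h).1, pow_succ]
      linear_combination y ^ (M ∩ B).card * hyz
    · simp only [if_neg hB, add_zero, ih₂]
      rw [Finset.insert_inter_of_notMem hB]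
      linear_combination y ^ (M ∩ B).card * hpr

end RunExpectation

/-! ### Crowding of a single constraint. -/

section Crowding

variable {α : Type*} [LinearOrder α] {f : Finset α → ℝ} {I : Finset α → Prop} {p r : ℝ}

/-- Dominates the count by the martingale on crowded runs: beyond `c + 1` the factor `z ^ j`
outgrows the count because `j + 1 ≤ 2 ^ j`. -/
theorem cast_le_potential {y z : ℝ} (hz : 2 ≤ z) (hy₀ : 0 < y) (hy₁ : y ≤ 1) {c k m : ℕ}
    (hk : c < k) (hm : m ≤ c) :
    (k : ℝ) ≤ (c + 1) * (z ^ (c + 1) * y ^ c)⁻¹ * (z ^ k * y ^ m) := by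
  obtain ⟨j, rfl⟩ := Nat.exists_eq_add_of_lt hk
  have hz₀ : 0 < z := by linarith
  have h₁ : ((c + j + 1 : ℕ) : ℝ) ≤ (c + 1) * z ^ j := by
    have h₂ : (1 : ℝ) + j ≤ z ^ j := by
      have h₃ : j + 1 ≤ 2 ^ j := Nat.lt_two_pow_self
      have h₄ : ((j + 1 : ℕ) : ℝ) ≤ 2 ^ j := by exact_mod_cast h₃
      push_cast at h₄
      linarith [pow_le_pow_left₀ zero_le_two hz j]
    have h₃ : (0 : ℝ) ≤ c * j := by positivity
    calc ((c + j + 1 : ℕ) : ℝ) ≤ (c + 1) * (1 + j) := by push_cast; linarith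
      _ ≤ (c + 1) * z ^ j := mul_le_mul_of_nonneg_left h₂ (by positivity)
  have h₂ : y ^ c ≤ y ^ m := pow_le_pow_of_le_one hy₀.le hy₁ hm
  have h₃ : (c + 1) * (z ^ (c + 1) * y ^ c)⁻¹ * (z ^ (c + j + 1) * y ^ m) =
      (c + 1) * z ^ j * (y ^ m / y ^ c) := by
    rw [show c + j + 1 = (c + 1) + j by ring, pow_add z (c + 1) j]
    field_simp
  rw [h₃]
  refine h₁.trans (le_mul_of_one_le_right (by positivity) ?_)
  exact (one_le_div (by positivity)).2 h₂

/-- The greedy weight of the candidates in a set `B` of capacity `c` is rarely concentrated on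
runs with more than `c` candidates in `B`. -/
theorem runExpect_crowded_le (hf : IsMonotoneSubmodularObjective f)
    (hI : ∀ S T : Finset α, S ⊆ T → I T → I S) (hp : 0 ≤ p) (hr : 0 ≤ r) (hpr : p + r = 1)
    {y z : ℝ} (hyz : p * y + r * z = 1) (hz : 2 ≤ z) (hy₀ : 0 < y) (hy₁ : y ≤ 1)
    {B : Finset α} {c : ℕ} (hc : ∀ S, I S → (S ∩ B).card ≤ c) {ε : ℝ} (hε₀ : 0 ≤ ε)
    (hε : (c + 1) * (z ^ (c + 1) * y ^ c)⁻¹ ≤ ε * r) (M R : Finset α) : I M → M ∩ B = ∅ →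
      runExpect p r f I M R (fun L => (if c < candidateCount B L then 1 else 0) *
        candidateWeight f (fun e => if e ∈ B then 1 else 0) M L) ≤
      ε * runExpect p r f I M R (candidateWeight f (fun e => if e ∈ B then 1 else 0) M) := by
  have hφ : ∀ e, (0 : ℝ) ≤ if e ∈ B then 1 else 0 := fun e => by positivity
  refine greedy_induction f I (P := fun M R => I M → M ∩ B = ∅ →
      runExpect p r f I M R (fun L => (if c < candidateCount B L then 1 else 0) *
        candidateWeight f (fun e => if e ∈ B then 1 else 0) M L) ≤
      ε * runExpect p r f I M R (candidateWeight f (fun e => if e ∈ B then 1 else 0) M))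
    ?_ ?_ M R
  · intro M R h _ _
    rw [runExpect_stop hpr h, runExpect_stop hpr h]
    simp [candidateWeight]
  · intro M R e he ih₁ ih₂ hM hMB
    by_cases hB : e ∈ B
    -- At the first pick in `B` the induction hypotheses are not needed. All later weights in `B`
    -- are at most `w`, so the crowded weight is at most `w` times the count, which the potential,
    -- now of expectation 1, dominates; `e` alone already contributes `r * w` to the total.
    · set w := f (insert e M) - f M with hw
      have hw₀ : 0 ≤ w := sub_nonneg.2 (hf.monotone _ _ (Finset.subset_insert e M))
      have hup : runExpect p r f I M R (fun L => (if c < candidateCount B L then 1 else 0) *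
          candidateWeight f (fun e => if e ∈ B then 1 else 0) M L) ≤
          runExpect p r f I M R (fun L => w * ((c + 1) * (z ^ (c + 1) * y ^ c)⁻¹) *
            (z ^ candidateCount B L * y ^ (chosen M L ∩ B).card)) := by
        refine runExpect_mono hp hr fun H _ => ?_
        split_ifs with hlt
        · rw [one_mul, mul_assoc]
          refine (candidateWeight_le hf hI H B (w := w) M R fun x hx => ?_).trans
            (mul_le_mul_of_nonneg_left (cast_le_potential hz hy₀ hy₁ hlt
              (hc _ (indep_chosen H M R hM))) hw₀)
          exact sub_le_sub_right (he.le hx) _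
        · rw [zero_mul]
          positivity
      rw [runExpect_mul, runExpect_potential hpr hyz, hMB, Finset.card_empty, pow_zero,
        mul_one] at hup
      have hlow : r * w ≤
          runExpect p r f I M R (candidateWeight f (fun e => if e ∈ B then 1 else 0) M) := by
        rw [runExpect_step p r he]
        simp only [candidateWeight, runExpect_add, runExpect_const hpr, if_pos hB, one_mul]
        have h₁ := mul_nonneg hp (runExpect_nonneg (f := f) (I := I) (M := insert e M)
          (R := R.erase e) hp hr hpr (candidateWeight_nonneg hf hφ (insert e M)))
        have h₂ := mul_nonneg hr (runExpect_nonneg (f := f) (I := I) (M := M)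
          (R := R.erase e) hp hr hpr (candidateWeight_nonneg hf hφ M))
        linarith
      have h₁ := mul_le_mul_of_nonneg_left hε hw₀
      have h₂ := mul_le_mul_of_nonneg_left hlow hε₀
      linarith
    · rw [runExpect_step p r he, runExpect_step p r he]
      simp only [candidateWeight, candidateCount, if_neg hB, zero_mul, zero_add, add_zero]
      have h₁ := mul_le_mul_of_nonneg_left
        (ih₁ he.indep (by rw [Finset.insert_inter_of_notMem hB, hMB])) hp
      have h₂ := mul_le_mul_of_nonneg_left (ih₂ hM hMB) hr
      have h₃ : ∀ a b, p * (ε * a) + r * (ε * b) = ε * (p * a + r * b) := fun a b => by ring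
      exact (add_le_add h₁ h₂).trans (h₃ _ _).le

end Crowding

/-! ### Reduced laminar families and matroid exchange. -/

section Laminar

/-- Keep the sets of positive capacity that have no proper superset of at most the same capacity.
Those through one element form a chain with strictly increasing capacities. -/
theorem IsLaminarMatroid.exists_family {α : Type*} [Fintype α] [DecidableEq α] {M : Matroid α}
    (hE : M.E = Set.univ) (h : IsLaminarMatroid M) :
    ∃ (𝒢 : Finset (Finset α)) (cap : Finset α → ℕ),
      (∀ B ∈ 𝒢, 1 ≤ cap B) ∧
      (∀ B ∈ 𝒢, ∀ C ∈ 𝒢, ∀ e, e ∈ B → e ∈ C → cap B = cap C → B = C) ∧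
      (∀ S : Finset α, M.Indep (S : Set α) → ∀ B ∈ 𝒢, (S ∩ B).card ≤ cap B) ∧
      ∀ (J : Finset α) (e : α), M.Indep (({e} : Finset α) : Set α) → M.Indep (J : Set α) →
        (∀ B ∈ 𝒢, e ∈ B → (insert e J ∩ B).card ≤ cap B) →
        M.Indep ((insert e J : Finset α) : Set α) := by
  classical
  obtain ⟨ℱ, cap, -, hlam, hind⟩ := h
  have hind' : ∀ S : Finset α, M.Indep (S : Set α) ↔
      ∀ B : Finset α, (B : Set α) ∈ ℱ → (S ∩ B).card ≤ cap B := by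
    intro S
    rw [hind S (hE ▸ Set.subset_univ _)]
    constructor
    · intro h B hB
      have := h B hB
      rw [← Finset.coe_inter, Set.encard_coe_eq_coe_finsetCard] at this
      exact_mod_cast this
    · intro h B hB
      have := h B.toFinset (by rwa [Set.coe_toFinset])
      rw [Set.coe_toFinset] at this
      rw [← Set.coe_toFinset B, ← Finset.coe_inter, Set.encard_coe_eq_coe_finsetCard,
        Set.coe_toFinset]
      exact_mod_cast this
  refine ⟨Finset.univ.filter fun B : Finset α => (B : Set α) ∈ ℱ ∧ 1 ≤ cap B ∧
    ∀ C : Finset α, (C : Set α) ∈ ℱ → B ⊆ C → cap C ≤ cap B → C = B,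
    fun B => cap B, ?_, ?_, ?_, ?_⟩
  · intro B hB
    exact (Finset.mem_filter.1 hB).2.2.1
  · intro B hB C hC e heB heC hcap
    obtain ⟨-, hB, -, hB'⟩ := Finset.mem_filter.1 hB
    obtain ⟨-, hC, -, hC'⟩ := Finset.mem_filter.1 hC
    rcases hlam _ hB _ hC with h | h | h
    · exact (hB' C hC (Finset.coe_subset.1 h) hcap.ge).symm
    · exact hC' B hB (Finset.coe_subset.1 h) hcap.le
    · exact absurd heC (Finset.disjoint_left.1 (Finset.disjoint_coe.1 h) heB)
  · intro S hS B hB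
    exact (hind' S).1 hS B (Finset.mem_filter.1 hB).2.1
  · intro J e he hJ hB
    rw [hind'] at he hJ ⊢
    intro B hBF
    by_cases heB : e ∈ B
    -- A largest `C ⊇ B` with capacity at most `cap B` is kept and implies the constraint of `B`.
    · obtain ⟨C, hC, hmax⟩ := Finset.exists_max_image
        (Finset.univ.filter fun C : Finset α => (C : Set α) ∈ ℱ ∧ B ⊆ C ∧ cap C ≤ cap B)
        Finset.card ⟨B, Finset.mem_filter.2 ⟨Finset.mem_univ _, hBF, subset_rfl, le_rfl⟩⟩
      obtain ⟨-, hCF, hBC, hcap⟩ := Finset.mem_filter.1 hC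
      have hone : 1 ≤ cap C := by
        have := he C hCF
        rwa [Finset.singleton_inter_of_mem (hBC heB), Finset.card_singleton] at this
      have hCG : C ∈ Finset.univ.filter fun B : Finset α => (B : Set α) ∈ ℱ ∧ 1 ≤ cap B ∧
          ∀ C : Finset α, (C : Set α) ∈ ℱ → B ⊆ C → cap C ≤ cap B → C = B := by
        refine Finset.mem_filter.2 ⟨Finset.mem_univ _, hCF, hone, fun D hD hCD hDC => ?_⟩
        have := hmax D (Finset.mem_filter.2
          ⟨Finset.mem_univ _, hD, hBC.trans hCD, hDC.trans hcap⟩)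
        exact (Finset.eq_of_subset_of_card_le hCD this).symm
      exact (Finset.card_le_card (Finset.inter_subset_inter_left hBC)).trans
        ((hB C hCG (hBC heB)).trans hcap)
    · rw [Finset.insert_inter_of_notMem heB]
      exact hJ B hBF

/-- A basis of `insert e A ∪ T` containing `insert e A` has at least `(A ∪ T).card` elements, so it
misses at most one element `t`. If it misses none of `T`, then `t = e` serves as a placeholder. -/
theorem Matroid.Indep.exists_finset_exchange {α : Type*} [DecidableEq α] (M : Matroid α)
    (A T : Finset α) (e : α) (hA : M.Indep ((insert e A : Finset α) : Set α))
    (hT : M.Indep ((A ∪ T : Finset α) : Set α)) :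
    ∃ t ∈ insert e T, ∃ T' ⊆ T.erase e, M.Indep ((insert e A ∪ T' : Finset α) : Set α) ∧
      T ⊆ insert e (insert t T') := by
  have hsub : ((insert e A : Finset α) : Set α) ⊆ ((insert e A ∪ T : Finset α) : Set α) :=
    Finset.coe_subset.2 Finset.subset_union_left
  have hsub' : ((A ∪ T : Finset α) : Set α) ⊆ ((insert e A ∪ T : Finset α) : Set α) :=
    Finset.coe_subset.2 (Finset.union_subset_union_left (Finset.subset_insert e A))
  have hX : ((insert e A ∪ T : Finset α) : Set α) ⊆ M.E := by
    rw [Finset.insert_union, Finset.coe_insert]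
    exact Set.insert_subset (hA.subset_ground (by simp)) hT.subset_ground
  obtain ⟨K, hK, hAK⟩ := hA.subset_isBasis_of_subset hsub hX
  obtain ⟨K', hK', hTK⟩ := hT.subset_isBasis_of_subset hsub' hX
  obtain ⟨K, rfl⟩ := ((Finset.finite_toSet _).subset hK.subset).exists_finset_coe
  have hcard : (A ∪ T).card ≤ K.card := by
    have := Set.encard_le_encard hTK
    rw [hK'.encard_eq_encard hK, Set.encard_coe_eq_coe_finsetCard,
      Set.encard_coe_eq_coe_finsetCard] at this
    exact_mod_cast this
  have hKX : K ⊆ insert e A ∪ T := Finset.coe_subset.1 hK.subset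
  have hAK : insert e A ⊆ K := Finset.coe_subset.1 hAK
  have hsdiff : ((insert e A ∪ T) \ K).card ≤ 1 := by
    have h₁ := Finset.card_sdiff_add_card_eq_card hKX
    have h₂ : (insert e A ∪ T).card ≤ (A ∪ T).card + 1 := by
      rw [Finset.insert_union]
      exact Finset.card_insert_le _ _
    omega
  have hindep : M.Indep ((insert e A ∪ (T.erase e ∩ K) : Finset α) : Set α) :=
    hK.indep.subset (Finset.coe_subset.2
      (Finset.union_subset hAK Finset.inter_subset_right))
  by_cases hTK : T ⊆ K
  · refine ⟨e, Finset.mem_insert_self e T, T.erase e ∩ K, Finset.inter_subset_left, hindep, ?_⟩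
    intro x hx
    by_cases hxe : x = e
    · simp [hxe]
    · simp [hx, hxe, hTK hx]
  · obtain ⟨t, ht, htK⟩ := Finset.not_subset.1 hTK
    refine ⟨t, Finset.mem_insert_of_mem ht, T.erase e ∩ K, Finset.inter_subset_left, hindep, ?_⟩
    intro x hx
    by_cases hxe : x = e
    · simp [hxe]
    · by_cases hxK : x ∈ K
      · simp [hx, hxe, hxK]
      · have : x = t := Finset.card_le_one.1 hsdiff x
          (Finset.mem_sdiff.2 ⟨Finset.mem_union_right _ hx, hxK⟩) t
          (Finset.mem_sdiff.2 ⟨Finset.mem_union_right _ ht, htK⟩)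
        simp [this]

end Laminar

/-! ### The competitive ratio. -/

section Analysis

/-- The fraction of the greedy weight that a set of capacity `c` loses by crowding. -/
noncomputable def crowdingLoss (c : ℕ) : ℝ := 3 / 2 * ((c + 1) * (35 / 288) ^ c)

theorem crowdingLoss_nonneg (c : ℕ) : 0 ≤ crowdingLoss c := by
  unfold crowdingLoss
  positivity

/-- The series `∑ (c + 1) u ^ c = (1 - u)⁻²` at `u = 35/288`, without its term at `c = 0`. -/
theorem sum_crowdingLoss_le (s : Finset ℕ) (hs : ∀ c ∈ s, 1 ≤ c) :
    ∑ c ∈ s, crowdingLoss c ≤ 3 / 2 * ((288 / 253) ^ 2 - 1) := by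
  have hu : ‖(35 / 288 : ℝ)‖ < 1 := by norm_num
  have h₁ := (hasSum_coe_mul_geometric_of_norm_lt_one hu).add
    (hasSum_geometric_of_norm_lt_one hu)
  have h₂ := sum_le_hasSum (insert 0 s) (fun c _ => by positivity) h₁
  rw [Finset.sum_insert fun h => absurd (hs 0 h) (by norm_num)] at h₂
  have h₃ : ∑ c ∈ s, crowdingLoss c =
      3 / 2 * ∑ c ∈ s, ((c : ℝ) * (35 / 288) ^ c + (35 / 288) ^ c) := by
    rw [Finset.mul_sum]
    refine Finset.sum_congr rfl fun c _ => ?_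
    rw [crowdingLoss]
    ring
  rw [h₃]
  norm_num at h₂ ⊢
  linarith

variable {α : Type*} [LinearOrder α] [Fintype α] {f : Finset α → ℝ} {I : Finset α → Prop}

/-- An online rule that accepts all candidates that lie in no crowded set is competitive. -/
theorem value_le_subsetExpect (hf : IsMonotoneSubmodularObjective f)
    (hI : ∀ S T : Finset α, S ⊆ T → I T → I S)
    (hX : ∀ (A T : Finset α) (e : α), I (insert e A) → I (A ∪ T) → ∃ t ∈ insert e T,
      ∃ T' ⊆ T.erase e, I (insert e A ∪ T') ∧ T ⊆ insert e (insert t T'))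
    {𝒢 : Finset (Finset α)} {cap : Finset α → ℕ} (hcap : ∀ B ∈ 𝒢, 1 ≤ cap B)
    (hinj : ∀ B ∈ 𝒢, ∀ C ∈ 𝒢, ∀ e, e ∈ B → e ∈ C → cap B = cap C → B = C)
    (hcard : ∀ S, I S → ∀ B ∈ 𝒢, (S ∩ B).card ≤ cap B) {Q : Finset α → Finset α}
    (hQ : ∀ H, ∀ e ∈ candidates (greedyRun f I H ∅ Finset.univ),
      (∀ B ∈ 𝒢, e ∈ B →
        (candidates (greedyRun f I H ∅ Finset.univ) ∩ B).card ≤ cap B) → e ∈ Q H)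
    {T : Finset α} (hT : I T) :
    1 / 144 * f T ≤ subsetExpect (35 / 36) (1 / 36) Finset.univ fun H => f (Q H) := by
  have hp : (0 : ℝ) ≤ 35 / 36 := by norm_num
  have hr : (0 : ℝ) ≤ 1 / 36 := by norm_num
  have hpr : (35 / 36 : ℝ) + 1 / 36 = 1 := by norm_num
  have hI₀ : I ∅ := hI _ _ (Finset.empty_subset T) hT
  set E : (List (α × Bool) → ℝ) → ℝ := runExpect (35 / 36) (1 / 36) f I ∅ Finset.univ with hE
  -- the value of the sample
  have hsample : 35 / 36 * f T ≤ 2 * E fun L => f (chosen ∅ L) := by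
    have h₁ := hf.le_subsetExpect_inter hp hr hpr T Finset.univ ∅
    have h₂ : (subsetExpect (35 / 36) (1 / 36) Finset.univ fun H => f (∅ ∪ T ∩ H)) ≤
        subsetExpect (35 / 36) (1 / 36) Finset.univ fun H =>
          2 * f (chosen ∅ (greedyRun f I H ∅ Finset.univ)) := by
      refine subsetExpect_mono hp hr fun H _ => ?_
      have h₃ := value_le_two_mul_chosen hf hI hX H ∅ Finset.univ (T ∩ H)
        (Finset.subset_univ _) Finset.inter_subset_right
        (by rw [Finset.empty_union]; exact hI _ _ Finset.inter_subset_left hT)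
      rw [Finset.empty_union]
      have h₄ := hf.monotone (T ∩ H) (chosen ∅ (greedyRun f I H ∅ Finset.univ) ∪ T ∩ H)
        Finset.subset_union_right
      linarith [hf.nonneg ∅]
    rw [subsetExpect_mul, Finset.inter_univ, Finset.empty_union] at *
    have h₃ := hf.nonneg ∅
    change _ ≤ 2 * E fun L => f (chosen ∅ L) at h₂
    linarith
  -- the loss by crowding
  have hloss : E (fun L => ∑ B ∈ 𝒢, (if cap B < candidateCount B L then 1 else 0) *
      candidateWeight f (fun e => if e ∈ B then 1 else 0) ∅ L) ≤
      3 / 2 * ((288 / 253) ^ 2 - 1) * E (candidateWeight f (fun _ => 1) ∅) := by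
    calc _ = ∑ B ∈ 𝒢, E (fun L => (if cap B < candidateCount B L then 1 else 0) *
          candidateWeight f (fun e => if e ∈ B then 1 else 0) ∅ L) :=
          subsetExpect_sum _ _ _ _ _
      _ ≤ ∑ B ∈ 𝒢, crowdingLoss (cap B) *
          E (candidateWeight f (fun e => if e ∈ B then 1 else 0) ∅) := by
          refine Finset.sum_le_sum fun B hB => ?_
          -- The martingale condition reads `35/36 * 12/35 + 1/36 * 24 = 1`, and `z * y = 288/35`
          -- gives the ratio in `crowdingLoss`.
          refine runExpect_crowded_le hf hI hp hr hpr (y := 12 / 35) (z := 24) (by norm_num)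
            (by norm_num) (by norm_num) (by norm_num) (fun S hS => hcard S hS B hB)
            (crowdingLoss_nonneg _) (le_of_eq ?_) _ _ hI₀ (Finset.empty_inter B)
          rw [crowdingLoss, pow_succ, mul_right_comm, ← mul_pow, mul_inv, ← inv_pow]
          norm_num
          ring
      _ = E (candidateWeight f
          (fun e => ∑ B ∈ 𝒢, crowdingLoss (cap B) * if e ∈ B then 1 else 0) ∅) := by
          simp only [← runExpect_mul, hE]
          rw [eq_comm]
          refine Eq.trans ?_ (subsetExpect_sum _ _ _ _ _)
          exact subsetExpect_congr fun H _ => candidateWeight_sum _ _ _ _ _ _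
      _ ≤ E (fun L => 3 / 2 * ((288 / 253) ^ 2 - 1) * candidateWeight f (fun _ => 1) ∅ L) := by
          refine runExpect_mono hp hr fun H _ => ?_
          rw [← candidateWeight_const]
          refine candidateWeight_mono hf (fun e => ?_) _ _
          simp only [mul_ite, mul_one, mul_zero, ← Finset.sum_filter]
          -- Sets through `e` have distinct capacities, so their losses may be summed over
          -- capacities.
          rw [← Finset.sum_image (f := crowdingLoss) (g := cap)]
          · refine sum_crowdingLoss_le _ fun c hc => ?_
            obtain ⟨B, hB, rfl⟩ := Finset.mem_image.1 hc
            exact hcap B (Finset.mem_filter.1 hB).1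
          · intro B hB C hC h
            rw [Finset.mem_coe, Finset.mem_filter] at hB hC
            exact hinj B hB.1 C hC.1 e hB.2 hC.2 h
      _ = _ := runExpect_mul _ _ _ _ _ _
  have hvalue : E (fun L => f ∅ + candidateGain f ∅ ∅ L) ≤
      E (fun L => ∑ B ∈ 𝒢, (if cap B < candidateCount B L then 1 else 0) *
        candidateWeight f (fun e => if e ∈ B then 1 else 0) ∅ L) +
      subsetExpect (35 / 36) (1 / 36) Finset.univ fun H => f (Q H) := by
    simp only [hE, runExpect]
    rw [← subsetExpect_add]
    refine subsetExpect_mono hp hr fun H _ => ?_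
    set L := greedyRun f I H ∅ Finset.univ with hL
    set G : Finset α :=
      Finset.univ.filter fun e => ∀ B ∈ 𝒢, e ∈ B → candidateCount B L ≤ cap B with hG
    have h₁ := gain_le_value hf G ∅ ∅ ∅ subset_rfl L
    have h₂ : f (∅ ∪ candidates L ∩ G) ≤ f (Q H) := by
      refine hf.monotone _ _ fun e he => ?_
      rw [Finset.empty_union, Finset.mem_inter, hG, Finset.mem_filter] at he
      exact hQ H e he.1 fun B hB heB => (card_candidates_inter_le B L).trans (he.2.2 B hB heB)
    have h₃ : candidateWeight f (fun e => if e ∈ G then 0 else 1) ∅ L ≤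
        ∑ B ∈ 𝒢, (if cap B < candidateCount B L then 1 else 0) *
          candidateWeight f (fun e => if e ∈ B then 1 else 0) ∅ L := by
      rw [← candidateWeight_sum]
      refine candidateWeight_mono hf (fun e => ?_) _ _
      have hnn : ∀ B ∈ 𝒢, (0 : ℝ) ≤
          (if cap B < candidateCount B L then 1 else 0) * if e ∈ B then 1 else 0 :=
        fun B _ => by positivity
      split_ifs with he
      · exact Finset.sum_nonneg hnn
      · simp only [hG, Finset.mem_filter, Finset.mem_univ, true_and, not_forall, not_le] at he
        obtain ⟨B, hB, heB, hlt⟩ := he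
        refine le_trans ?_ (Finset.single_le_sum hnn hB)
        rw [if_pos hlt, if_pos heB, mul_one]
    linarith
  have hgain := le_runExpect_gain (I := I) hf hr hpr hp ∅ Finset.univ ∅
  have hweight := mul_runExpect_weight (f := f) (I := I) hpr ∅ Finset.univ
  rw [Finset.empty_union] at hgain
  rw [hE, runExpect_add, runExpect_const hpr] at hvalue
  rw [← hE] at hgain hweight hvalue
  have h₀ := hf.nonneg ∅
  have hT₀ := hf.nonneg T
  -- By `hweight` the loss is at most `36/35 * 56805/128018 < 0.457` of the gain bound, which leaves
  -- about `1/36 * 0.543 * 35/72 ≈ 0.0073` of `f T`, above `1/144`.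
  have hconst : (3 / 2 * ((288 / 253) ^ 2 - 1) : ℝ) = 56805 / 128018 := by norm_num
  rw [hconst] at hloss
  linarith

end Analysis

/-! ### The online algorithm. -/

section Algorithm

/-- A rearrangement of the labels that puts those in `H` first. -/
def sampleFirst {n : ℕ} (H : Finset (Fin n)) : Equiv.Perm (Fin n) :=
  (Tuple.sort fun i => if i ∈ H then 0 else 1).symm

theorem sampleFirst_lt {n : ℕ} {H : Finset (Fin n)} {a b : Fin n} (ha : a ∈ H) (hb : b ∉ H) :
    sampleFirst H a < sampleFirst H b := by
  by_contra! h
  have := Tuple.monotone_sort (fun i => if i ∈ H then 0 else 1) h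
  simp [sampleFirst, ha, hb] at this

/-- The label `a` is a candidate: it lies outside the sample `H`, and the greedy algorithm picks it
when it is added to the sample. -/
def IsCandidate {n : ℕ} (f : Finset (Fin n) → ℝ) (I : Finset (Fin n) → Prop)
    (H : Finset (Fin n)) (a : Fin n) : Prop :=
  (a, false) ∈ greedyRun f I H ∅ (insert a H)

/-- The label `a` is accepted: it is a candidate, and it can be added to every independent set of
candidates that arrive earlier. -/
def IsAccepted {n : ℕ} (f : Finset (Fin n) → ℝ) (I : Finset (Fin n) → Prop)
    (H : Finset (Fin n)) (a : Fin n) : Prop :=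
  a ∉ H ∧ IsCandidate f I H a ∧
    ∀ J : Finset (Fin n),
      (∀ b ∈ J, sampleFirst H b < sampleFirst H a ∧ b ∉ H ∧ IsCandidate f I H b) →
        I J → I (insert a J)

theorem isCandidate_congr {n : ℕ} {f f' : Finset (Fin n) → ℝ} {I I' : Finset (Fin n) → Prop}
    {H A : Finset (Fin n)} {a : Fin n} (hf : ∀ S ⊆ A, f S = f' S) (hI : ∀ S ⊆ A, I S ↔ I' S)
    (hA : insert a H ⊆ A) : IsCandidate f I H a ↔ IsCandidate f' I' H a := by
  rw [IsCandidate, IsCandidate,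
    greedyRun_congr_oracle hf hI ∅ (insert a H) (Finset.empty_subset A) hA]

/-- Identifies the test made on arrival with the full run used in the analysis. -/
theorem isCandidate_iff {n : ℕ} (f : Finset (Fin n) → ℝ) (I : Finset (Fin n) → Prop)
    (H : Finset (Fin n)) (a : Fin n) :
    IsCandidate f I H a ↔ a ∈ candidates (greedyRun f I H ∅ Finset.univ) := by
  rw [mem_candidates, IsCandidate,
    mem_greedyRun_iff f I H a ∅ Finset.univ (insert a H) (Finset.subset_univ _)
      Finset.inter_subset_right]

/-- Acceptance of `a` depends only on sets of labels that arrive no later than `a`. -/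
theorem isAccepted_congr {n : ℕ} {f f' : Finset (Fin n) → ℝ} {I I' : Finset (Fin n) → Prop}
    {H : Finset (Fin n)} {a : Fin n}
    (hf : ∀ S : Finset (Fin n), (∀ b ∈ S, sampleFirst H b ≤ sampleFirst H a) → f S = f' S)
    (hI : ∀ S : Finset (Fin n), (∀ b ∈ S, sampleFirst H b ≤ sampleFirst H a) → (I S ↔ I' S)) :
    IsAccepted f I H a ↔ IsAccepted f' I' H a := by
  refine and_congr_right fun haH => ?_
  have hcand : ∀ b, sampleFirst H b ≤ sampleFirst H a →
      (IsCandidate f I H b ↔ IsCandidate f' I' H b) := by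
    intro b hb
    refine isCandidate_congr
      (A := Finset.univ.filter fun b => sampleFirst H b ≤ sampleFirst H a)
      (fun S hS => hf S fun b hb => (Finset.mem_filter.1 (hS hb)).2)
      (fun S hS => hI S fun b hb => (Finset.mem_filter.1 (hS hb)).2) ?_
    refine Finset.insert_subset (Finset.mem_filter.2 ⟨Finset.mem_univ _, hb⟩) fun x hx => ?_
    exact Finset.mem_filter.2 ⟨Finset.mem_univ _, (sampleFirst_lt hx haH).le⟩
  refine and_congr (hcand a le_rfl) (forall_congr' fun J => ?_)
  have hJ : (∀ b ∈ J, sampleFirst H b < sampleFirst H a ∧ b ∉ H ∧ IsCandidate f I H b) ↔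
      ∀ b ∈ J, sampleFirst H b < sampleFirst H a ∧ b ∉ H ∧ IsCandidate f' I' H b :=
    forall₂_congr fun b _ => and_congr_right fun hb => and_congr_right fun _ => hcand b hb.le
  rw [hJ]
  refine imp_congr_right fun h => ?_
  rw [hI J fun b hb => (h b hb).1.le, hI (insert a J) fun b hb => ?_]
  rcases Finset.mem_insert.1 hb with rfl | hb
  · exact le_rfl
  · exact (h b hb).1.le

/-- Induction on arrival time: the last label can be added to the others because they form one of
the sets `J` quantified over in `IsAccepted`. -/
theorem indep_of_forall_isAccepted {n : ℕ} {f : Finset (Fin n) → ℝ}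
    {I : Finset (Fin n) → Prop} {H : Finset (Fin n)} (hI : I ∅) (Q : Finset (Fin n)) :
    (∀ a ∈ Q, IsAccepted f I H a) → I Q := by
  induction Q using Finset.induction_on_max_value (sampleFirst H) with
  | empty => exact fun _ => hI
  | insert a Q haQ hmax ih =>
    intro h
    refine (h a (Finset.mem_insert_self a Q)).2.2 Q (fun b hb => ?_)
      (ih fun b hb => h b (Finset.mem_insert_of_mem hb))
    have hb' := h b (Finset.mem_insert_of_mem hb)
    refine ⟨lt_of_le_of_ne (hmax b hb) fun heq => ?_, hb'.1, hb'.2.1⟩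
    exact haQ ((sampleFirst H).injective heq ▸ hb)

/-- The distribution of a set that contains each label independently with probability `35 / 36`. -/
noncomputable def sampleCoin (n : ℕ) : PMF (Finset (Fin n)) :=
  PMF.ofFintype
    (fun H => ENNReal.ofReal ((35 / 36 : ℝ) ^ H.card * (1 / 36) ^ (n - H.card))) <| by
    rw [← ENNReal.ofReal_sum_of_nonneg fun H _ => by positivity, ← Finset.powerset_univ]
    have := subsetExpect_const (p := 35 / 36) (r := 1 / 36) (by norm_num)
      (Finset.univ : Finset (Fin n)) 1
    simp only [subsetExpect, mul_one, Finset.card_univ, Fintype.card_fin] at this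
    rw [this, ENNReal.ofReal_one]

theorem sampleCoin_toReal {n : ℕ} (H : Finset (Fin n)) :
    (sampleCoin n H).toReal = (35 / 36) ^ H.card * (1 / 36) ^ (n - H.card) := by
  rw [sampleCoin, PMF.ofFintype_apply, ENNReal.toReal_ofReal (by positivity)]

open Classical in
/-- The simulated greedy algorithm.  The seed is the set `H` of labels that form the sample; the
element that arrives at time `i` has the label `(sampleFirst H).symm i`. -/
noncomputable def simulatedGreedy : SecretaryAlgorithm where
  Seed := fun n => Finset (Fin n)
  seedFintype := fun _ => inferInstance
  coin := sampleCoin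
  accept := fun _ H i value indep =>
    IsAccepted
      (fun S => if h : S.map (sampleFirst H).toEmbedding ⊆ Finset.Iic i then value _ h else 0)
      (fun S => ∃ h : S.map (sampleFirst H).toEmbedding ⊆ Finset.Iic i, indep _ h)
      H ((sampleFirst H).symm i)

open Classical in
/-- The set of accepted labels. -/
noncomputable def acceptedSet {n : ℕ} (f : Finset (Fin n) → ℝ) (I : Finset (Fin n) → Prop)
    (H : Finset (Fin n)) : Finset (Fin n) :=
  Finset.univ.filter (IsAccepted f I H)

theorem mem_acceptedSet {n : ℕ} {f : Finset (Fin n) → ℝ} {I : Finset (Fin n) → Prop}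
    {H : Finset (Fin n)} {a : Fin n} : a ∈ acceptedSet f I H ↔ IsAccepted f I H a := by
  classical
  simp [acceptedSet]

theorem simulatedGreedy_output {E : Type*} [Fintype E] (f : Finset E → ℝ) (M : Matroid E)
    (σ : Fin (Fintype.card E) ≃ E) (H : Finset (Fin (Fintype.card E))) :
    simulatedGreedy.output f M σ H =
      (acceptedSet (fun S => f (S.map ((sampleFirst H).trans σ).toEmbedding))
        (fun S => M.Indep (S.map ((sampleFirst H).trans σ).toEmbedding : Finset E)) H).map
        ((sampleFirst H).trans σ).toEmbedding := by
  classical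
  ext e
  rw [Finset.mem_map_equiv]
  rw [mem_acceptedSet]
  simp only [SecretaryAlgorithm.output, Finset.mem_filter, Finset.mem_univ, true_and]
  have hsub : ∀ S : Finset (Fin (Fintype.card E)),
      (∀ b ∈ S, sampleFirst H b ≤
        sampleFirst H (((sampleFirst H).trans σ).symm e)) →
      S.map (sampleFirst H).toEmbedding ⊆ Finset.Iic (σ.symm e) := by
    intro S hS x hx
    obtain ⟨b, hb, rfl⟩ := Finset.mem_map.1 hx
    have := hS b hb
    simpa using this
  -- The default answers on sets that have not fully arrived never matter, because acceptance
  -- queries only arrived sets.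
  refine isAccepted_congr (fun S hS => ?_) (fun S hS => ?_)
  · refine (dif_pos (hsub S hS)).trans ?_
    change f ((S.map _).map _) = _
    rw [Finset.map_map]
    rfl
  · refine (exists_prop_of_true (hsub S hS)).trans ?_
    change M.Indep (((S.map _).map _ : Finset E) : Set E) ↔ _
    rw [Finset.map_map]
    rfl

end Algorithm

/-! ### Relabelling and the final averaging. -/

section Main

theorem IsLaminarMatroid.comap {α β : Type*} {M : Matroid β} (h : IsLaminarMatroid M)
    (e : α ≃ β) : IsLaminarMatroid (M.comap e) := by
  obtain ⟨ℱ, cap, hE, hlam, hind⟩ := h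
  refine ⟨{B | e '' B ∈ ℱ}, fun B => cap (e '' B), ?_, ?_, ?_⟩
  · intro B hB
    exact Set.image_subset_iff.1 (hE _ hB)
  · intro B hB C hC
    simpa only [Set.image_subset_image_iff e.injective, Set.disjoint_image_iff e.injective] using
      hlam _ hB _ hC
  · intro S hS
    rw [Matroid.comap_indep_iff, and_iff_left e.injective.injOn,
      hind _ (Set.image_subset_iff.2 hS)]
    constructor
    · intro h B hB
      have := h _ hB
      rwa [← Set.image_inter e.injective, e.injective.encard_image] at this
    · intro h B hB
      have hB' : e '' (e ⁻¹' B) = B := Set.image_preimage_eq B e.surjective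
      have : (S ∩ e ⁻¹' B).encard ≤ cap (e '' (e ⁻¹' B)) :=
        h _ (show e '' (e ⁻¹' B) ∈ ℱ by rwa [hB'])
      rwa [hB', ← e.injective.encard_image, Set.image_inter e.injective, hB'] at this

theorem IsMonotoneSubmodularObjective.map {α β : Type*} {f : Finset β → ℝ}
    (hf : IsMonotoneSubmodularObjective f) (e : α ≃ β) :
    IsMonotoneSubmodularObjective fun S : Finset α => f (S.map e.toEmbedding) where
  nonneg S := hf.nonneg _
  monotone S T h := hf.monotone _ _ (Finset.map_subset_map.2 h)
  submodular A B a haA haB h := by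
    simp only [Finset.map_cons]
    exact hf.submodular _ _ _ _ _ (Finset.map_subset_map.2 h)

/-- Averaging over the sample alone, the simulated greedy rule is competitive for every labelling
of the elements. -/
theorem value_le_acceptedSet {n : ℕ} {f : Finset (Fin n) → ℝ}
    (hf : IsMonotoneSubmodularObjective f) {M : Matroid (Fin n)} (hE : M.E = Set.univ)
    (hM : IsLaminarMatroid M) {T : Finset (Fin n)} (hT : M.Indep (T : Set (Fin n))) :
    1 / 144 * f T ≤ subsetExpect (35 / 36) (1 / 36) Finset.univ fun H =>
      f (acceptedSet f (fun S => M.Indep (S : Set (Fin n))) H) := by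
  obtain ⟨𝒢, cap, hcap, hinj, hcard, hins⟩ := hM.exists_family hE
  have hI : ∀ S T : Finset (Fin n), S ⊆ T → M.Indep (T : Set (Fin n)) →
      M.Indep (S : Set (Fin n)) := fun S T h hT => hT.subset (Finset.coe_subset.2 h)
  refine value_le_subsetExpect hf (I := fun S => M.Indep (S : Set (Fin n))) hI
    (Matroid.Indep.exists_finset_exchange M) hcap hinj hcard (fun H a ha hB => ?_) hT
  -- Sets of capacity zero are absent from `𝒢`, so that candidates are not loops must come from the
  -- run itself.
  have hrun : ∀ M' R, ∀ x ∈ candidates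
      (greedyRun f (fun S => M.Indep (S : Set (Fin n))) H M' R),
      x ∉ H ∧ M.Indep (({x} : Finset (Fin n)) : Set (Fin n)) := by
    refine greedy_induction f (fun S => M.Indep (S : Set (Fin n))) (P := fun M' R =>
      ∀ x ∈ candidates (greedyRun f (fun S => M.Indep (S : Set (Fin n))) H M' R),
      x ∉ H ∧ M.Indep (({x} : Finset (Fin n))  : Set (Fin n)))
      (fun M' R h => ?_) (fun M' R e he ih₁ ih₂ => ?_)
    · rw [greedyRun_stop f H h]
      simp [candidates]
    · by_cases h : e ∈ H
      · rw [greedyRun_mem he h]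
        exact ih₁
      · rw [greedyRun_notMem he h]
        intro x hx
        rcases Finset.mem_insert.1 hx with rfl | hx
        · exact ⟨h, hI _ _ (Finset.singleton_subset_iff.2 (Finset.mem_insert_self _ _)) he.indep⟩
        · exact ih₂ x hx
  obtain ⟨haH, haI⟩ := hrun _ _ a ha
  refine mem_acceptedSet.2 ⟨haH, (isCandidate_iff _ _ _ _).2 ha, ?_⟩
  intro J hJ hJI
  refine hins J a haI hJI fun B hBG haB => le_trans (Finset.card_le_card ?_) (hB B hBG haB)
  refine Finset.inter_subset_inter_right (Finset.insert_subset ha fun b hb => ?_)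
  exact (isCandidate_iff _ _ _ _).1 (hJ b hb).2.2

theorem mainTheorem10 :
    ∃ A : SecretaryAlgorithm,
      ∀ (E : Type*) [Fintype E] (M : Matroid E), M.E = Set.univ → IsLaminarMatroid M →
        IsCompetitiveForMSMSP A 144 M := by
  refine ⟨simulatedGreedy, fun E _ M hE hM f hf =>
    ⟨fun σ (H : Finset (Fin (Fintype.card E))) => ?_, ?_⟩⟩
  · rw [simulatedGreedy_output f M σ H]
    refine indep_of_forall_isAccepted (H := H)
      (f := fun S => f (S.map ((sampleFirst H).trans σ).toEmbedding))
      (I := fun S => M.Indep (S.map ((sampleFirst H).trans σ).toEmbedding : Finset E))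
      (by simp) _ fun a ha => ?_
    exact mem_acceptedSet.1 ha
  · classical
    set n := Fintype.card E with hn
    have key : ∀ T : Finset E, M.Indep (T : Set E) →
        1 / 144 * f T ≤ simulatedGreedy.expectedValue f M := by
      intro T hT
      have hlabel : ∀ l : Fin n ≃ E, 1 / 144 * f T ≤
          subsetExpect (35 / 36) (1 / 36) Finset.univ fun H =>
            f ((acceptedSet (fun S => f (S.map l.toEmbedding))
              (fun S => M.Indep (S.map l.toEmbedding : Finset E)) H).map l.toEmbedding) := by
        intro l
        have hcomap : ∀ S : Finset (Fin n), (M.comap l).Indep (S : Set (Fin n)) ↔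
            M.Indep (S.map l.toEmbedding : Finset E) := by
          intro S
          rw [Matroid.comap_indep_iff, and_iff_left l.injective.injOn, Finset.coe_map]
          rfl
        have hTl : (T.map l.symm.toEmbedding).map l.toEmbedding = T := by
          ext x
          simp
        have h := value_le_acceptedSet (hf.map l) (M := M.comap l)
          (by rw [Matroid.comap_ground_eq, hE, Set.preimage_univ]) (hM.comap l)
          (T := T.map l.symm.toEmbedding) ((hcomap _).2 (by rwa [hTl]))
        simp only [hTl, hcomap] at h
        exact h
      have hcard : (0 : ℝ) < Fintype.card (Fin n ≃ E) := by
        have : Nonempty (Fin n ≃ E) := ⟨(Fintype.equivFin E).symm⟩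
        exact_mod_cast Fintype.card_pos
      have hsum : ∑ σ : Fin n ≃ E, ∑ H : Finset (Fin n),
          (sampleCoin n H).toReal * f (simulatedGreedy.output f M σ H) =
          ∑ l : Fin n ≃ E, subsetExpect (35 / 36) (1 / 36) Finset.univ fun H =>
            f ((acceptedSet (fun S => f (S.map l.toEmbedding))
              (fun S => M.Indep (S.map l.toEmbedding : Finset E)) H).map l.toEmbedding) := by
        simp only [subsetExpect, Finset.powerset_univ]
        rw [Finset.sum_comm]
        conv_rhs => rw [Finset.sum_comm]
        refine Finset.sum_congr rfl fun H _ => ?_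
        -- For fixed `H`, composition with `sampleFirst H` permutes the bijections, so the labelling
        -- is uniform and independent of the sample even though sampled labels always arrive first.
        refine Fintype.sum_equiv ((sampleFirst H).symm.equivCongr (Equiv.refl E)) _ _ fun σ => ?_
        rw [sampleCoin_toReal, simulatedGreedy_output, Finset.card_univ, Fintype.card_fin]
        rfl
      have hexp : simulatedGreedy.expectedValue f M =
          (∑ σ : Fin n ≃ E, ∑ H : Finset (Fin n),
            (sampleCoin n H).toReal * f (simulatedGreedy.output f M σ H)) /
            Fintype.card (Fin n ≃ E) := by
        rfl
      rw [hexp, hsum, le_div_iff₀ hcard]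
      refine le_trans (le_of_eq ?_) (Finset.sum_le_sum fun l _ => hlabel l)
      rw [Finset.sum_const, nsmul_eq_mul, Finset.card_univ, mul_comm]
    have hne : Nonempty {T : Finset E // M.Indep (T : Set E)} := ⟨⟨∅, by simp⟩⟩
    have hsup : offlineOptimum f M ≤ 144 * simulatedGreedy.expectedValue f M :=
      ciSup_le fun T => by linarith [key T.1 T.2]
    linarith

end Main
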